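/- Let $\check\otimes$ denote the spatial (minimal) tensor product of unital $C^*$-algebras. A unital $C^*$-algebra $\mathcal A$ has spatially continuous multiplication if the linear map $a\otimes b\mapsto ab$ on the algebraic tensor product of $\mathcal A$ with itself is continuous for the spatial norm; $m:\mathcal A\check\otimes\mathcal A\to\mathcal A$ then denotes its continuous extension. Let $\mathfrak F:\mathcal A\check\otimes\mathcal A\to\mathcal A\check\otimes\mathcal A$ be the flip, $\mathfrak F(a\otimes b)=b\otimes a$, and let $\mathfrak M:\mathcal A\check\otimes\mathcal A\to\mathcal A\check\otimes\mathcal A\check\otimes\mathcal A$ be the $*$-homomorphism with $\mathfrak M(a\otimes b)=a\otimes 1\otimes b$. An algebraic compact quantum metric space is a pair $(\mathcal A,\rho)$ of a unital $C^*$-algebra $\mathcal A$ with spatially continuous multiplication and an element $\rho\in\mathcal A\check\otimes\mathcal A$ such that (i) $\rho\ge 0$; (ii) $m(\rho)=0$; (iii) for every $\nu\in\mathcal A\check\otimes\mathcal A$ with $\nu\ge 0$, $m(\nu)=1$ and $\mathfrak F(\nu)=\nu$, the element $\rho+\nu$ is invertible in $\mathcal A\check\otimes\mathcal A$; (iv)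 $\mathfrak F(\rho)=\rho$; (v) $\mathfrak M(\rho)\le \rho\otimes 1+1\otimes\rho$. Theorem. Let $(\mathcal A_1,\rho_1)$ and $(\mathcal A_2,\rho_2)$ be algebraic compact quantum metric spaces such that $\mathcal A_1$ is commutative. Then $(\mathcal A_1\check\otimes\mathcal A_2,\rho)$ is an algebraic compact quantum metric space, where $$\rho=\rho_1\otimes 1_{\mathcal A_2\check\otimes\mathcal A_2}+1_{\mathcal A_1\check\otimes\mathcal A_1}\otimes\rho_2\in(\mathcal A_1\check\otimes\mathcal A_1)\check\otimes(\mathcal A_2\check\otimes\mathcal A_2)\cong(\mathcal A_1\check\otimes\mathcal A_2)\check\otimes(\mathcal A_1\check\otimes\mathcal A_2),$$ the isomorphism being $(a\otimes a')\otimes(b\otimes b')\mapsto(a\otimes b)\otimes(a'\otimes b')$. -/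

import Mathlib

open scoped TensorProduct

universe u

noncomputable section

/-! ## The Hilbert space tensor product and tensor products of operators -/

section HilbertTensor

variable (H K : Type*) [NormedAddCommGroup H] [InnerProductSpace ℂ H] [CompleteSpace H]
  [NormedAddCommGroup K] [InnerProductSpace ℂ K] [CompleteSpace K]

/-- The Hilbert space tensor product of `H` and `K`: the completion of the algebraic tensor product
for the inner product `⟪x ⊗ y, x' ⊗ y'⟫ = ⟪x, x'⟫ ⟪y, y'⟫`. -/
def HilbertTensor : Type _ := UniformSpace.Completion (H ⊗[ℂ] K)

instance : NormedAddCommGroup (HilbertTensor H K) :=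
  inferInstanceAs (NormedAddCommGroup (UniformSpace.Completion (H ⊗[ℂ] K)))

instance : InnerProductSpace ℂ (HilbertTensor H K) :=
  inferInstanceAs (InnerProductSpace ℂ (UniformSpace.Completion (H ⊗[ℂ] K)))

instance : CompleteSpace (HilbertTensor H K) :=
  inferInstanceAs (CompleteSpace (UniformSpace.Completion (H ⊗[ℂ] K)))

/-- The canonical isometric embedding of the algebraic tensor product. -/
def HilbertTensor.of : H ⊗[ℂ] K →ₗᵢ[ℂ] HilbertTensor H K :=
  (UniformSpace.Completion.toComplₗᵢ : H ⊗[ℂ] K →ₗᵢ[ℂ] UniformSpace.Completion (H ⊗[ℂ] K))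

variable {H K}

@[elab_as_elim]
theorem HilbertTensor.induction_on {p : HilbertTensor H K → Prop} (x : HilbertTensor H K)
    (hp : IsClosed {x | p x}) (ih : ∀ x, p (HilbertTensor.of H K x)) : p x :=
  UniformSpace.Completion.induction_on x hp ih

theorem inner_rTensor_adjoint (T : H →L[ℂ] H) (x y : H ⊗[ℂ] K) :
    inner ℂ ((T : H →ₗ[ℂ] H).rTensor K x) y =
      inner ℂ x (((star T : H →L[ℂ] H) : H →ₗ[ℂ] H).rTensor K y) := by
  induction x with
  | zero => simp
  | add x x' hx hx' => simp [inner_add_left, hx, hx']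
  | tmul a b =>
    induction y with
    | zero => simp
    | add y y' hy hy' => simp only [map_add, inner_add_right, hy, hy']
    | tmul c d =>
      simp [ContinuousLinearMap.star_eq_adjoint, ContinuousLinearMap.adjoint_inner_right]

theorem norm_rTensor_le (T : H →L[ℂ] H) (x : H ⊗[ℂ] K) :
    ‖(T : H →ₗ[ℂ] H).rTensor K x‖ ≤ ‖T‖ * ‖x‖ := by
  have h0 : 0 ≤ algebraMap ℝ (H →L[ℂ] H) (‖T‖ ^ 2) - star T * T :=
    sub_nonneg.2 CStarAlgebra.star_mul_le_algebraMap_norm_sq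
  obtain ⟨R, hR⟩ := CStarAlgebra.nonneg_iff_eq_star_mul_self.1 h0
  have key (S : H →L[ℂ] H) : ((‖(S : H →ₗ[ℂ] H).rTensor K x‖ : ℂ) ^ 2) =
      inner ℂ x (((star S * S : H →L[ℂ] H) : H →ₗ[ℂ] H).rTensor K x) := by
    have := inner_self_eq_norm_sq_to_K (𝕜 := ℂ) ((S : H →ₗ[ℂ] H).rTensor K x)
    rw [inner_rTensor_adjoint] at this
    rw [← LinearMap.comp_apply, ← LinearMap.rTensor_comp] at this
    rw [ContinuousLinearMap.toLinearMap_mul, Module.End.mul_eq_comp]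
    simpa using this.symm
  have hsum : (algebraMap ℝ (H →L[ℂ] H) (‖T‖ ^ 2) : H →L[ℂ] H) = star T * T + star R * R := by
    rw [← hR]; abel
  have h1 : inner ℂ x (((algebraMap ℝ (H →L[ℂ] H) (‖T‖ ^ 2) : H →L[ℂ] H) :
      H →ₗ[ℂ] H).rTensor K x) = (‖T‖ : ℂ) ^ 2 * (‖x‖ : ℂ) ^ 2 := by
    have : ((algebraMap ℝ (H →L[ℂ] H) (‖T‖ ^ 2) : H →L[ℂ] H) : H →ₗ[ℂ] H) =
        ((‖T‖ : ℂ) ^ 2) • LinearMap.id := by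
      ext y
      simp [Algebra.algebraMap_eq_smul_one, ← Complex.coe_smul]
    rw [this, LinearMap.rTensor_smul, LinearMap.rTensor_id]
    simp [inner_smul_right, inner_self_eq_norm_sq_to_K]
  rw [hsum, ContinuousLinearMap.toLinearMap_add, LinearMap.rTensor_add, LinearMap.add_apply,
    inner_add_right, ← key, ← key] at h1
  have h2 : ‖(T : H →ₗ[ℂ] H).rTensor K x‖ ^ 2 + ‖(R : H →ₗ[ℂ] H).rTensor K x‖ ^ 2 =
      (‖T‖ * ‖x‖) ^ 2 := by
    rw [mul_pow]; exact_mod_cast h1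
  have h3 : ‖(T : H →ₗ[ℂ] H).rTensor K x‖ ^ 2 ≤ (‖T‖ * ‖x‖) ^ 2 := by
    nlinarith [sq_nonneg ‖(R : H →ₗ[ℂ] H).rTensor K x‖]
  exact le_of_sq_le_sq h3 (by positivity)

theorem norm_lTensor_le (S : K →L[ℂ] K) (x : H ⊗[ℂ] K) :
    ‖(S : K →ₗ[ℂ] K).lTensor H x‖ ≤ ‖S‖ * ‖x‖ := by
  have h := norm_rTensor_le S (TensorProduct.comm ℂ H K x)
  rw [TensorProduct.norm_comm] at h
  rw [← TensorProduct.norm_comm]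
  convert h using 2
  rw [← LinearMap.comm_comp_lTensor_comp_comm_eq]
  simp

/-- The bounded operator `T ⊗ S` on the algebraic tensor product. -/
def algTensorOp (T : H →L[ℂ] H) (S : K →L[ℂ] K) : H ⊗[ℂ] K →L[ℂ] H ⊗[ℂ] K :=
  (TensorProduct.map (T : H →ₗ[ℂ] H) (S : K →ₗ[ℂ] K)).mkContinuous (‖T‖ * ‖S‖) (by
    intro x
    rw [← LinearMap.rTensor_comp_lTensor, LinearMap.comp_apply, mul_assoc]
    exact (norm_rTensor_le T _).trans
      (mul_le_mul_of_nonneg_left (norm_lTensor_le S x) (norm_nonneg T)))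

/-- The bounded operator `T ⊗ S` on the Hilbert space tensor product. -/
def tensorOp (T : H →L[ℂ] H) (S : K →L[ℂ] K) : HilbertTensor H K →L[ℂ] HilbertTensor H K :=
  ((algTensorOp T S).completion :
    UniformSpace.Completion (H ⊗[ℂ] K) →L[ℂ] UniformSpace.Completion (H ⊗[ℂ] K))

theorem tensorOp_of (T : H →L[ℂ] H) (S : K →L[ℂ] K) (x : H ⊗[ℂ] K) :
    tensorOp T S (HilbertTensor.of H K x) =
      HilbertTensor.of H K (TensorProduct.map (T : H →ₗ[ℂ] H) (S : K →ₗ[ℂ] K) x) :=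
  (algTensorOp T S).completion_apply_coe x

theorem tensorOp_of_tmul (T : H →L[ℂ] H) (S : K →L[ℂ] K) (a : H) (b : K) :
    tensorOp T S (HilbertTensor.of H K (a ⊗ₜ b)) = HilbertTensor.of H K (T a ⊗ₜ S b) := by
  rw [tensorOp_of]; rfl

theorem tensorOp_ext {E : Type*} [NormedAddCommGroup E] [NormedSpace ℂ E]
    {f g : HilbertTensor H K →L[ℂ] E}
    (h : ∀ (a : H) (b : K), f (HilbertTensor.of H K (a ⊗ₜ b)) =
      g (HilbertTensor.of H K (a ⊗ₜ b))) : f = g := by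
  ext x
  induction x using HilbertTensor.induction_on with
  | hp => exact isClosed_eq f.continuous g.continuous
  | ih x =>
    induction x with
    | zero => simp only [map_zero]
    | add x y hx hy => simp only [map_add, hx, hy]
    | tmul a b => exact h a b

theorem norm_tensorOp_le (T : H →L[ℂ] H) (S : K →L[ℂ] K) : ‖tensorOp T S‖ ≤ ‖T‖ * ‖S‖ := by
  refine ContinuousLinearMap.opNorm_le_bound _ (by positivity) fun x => ?_
  induction x using HilbertTensor.induction_on with
  | hp => exact isClosed_le (by fun_prop) (by fun_prop)
  | ih x =>
    rw [tensorOp_of, LinearIsometry.norm_map, LinearIsometry.norm_map,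
      ← LinearMap.rTensor_comp_lTensor, LinearMap.comp_apply, mul_assoc]
    exact (norm_rTensor_le T _).trans
      (mul_le_mul_of_nonneg_left (norm_lTensor_le S x) (norm_nonneg T))

theorem tensorOp_mul (T T' : H →L[ℂ] H) (S S' : K →L[ℂ] K) :
    tensorOp (T * T') (S * S') = tensorOp T S * tensorOp T' S' :=
  tensorOp_ext fun a b => by
    simp only [mul_apply_eq_comp, tensorOp_of_tmul]

theorem tensorOp_one : tensorOp (1 : H →L[ℂ] H) (1 : K →L[ℂ] K) = 1 :=
  tensorOp_ext fun a b => by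
    simp only [one_apply_eq_self, tensorOp_of_tmul]

theorem tensorOp_star (T : H →L[ℂ] H) (S : K →L[ℂ] K) :
    tensorOp (star T) (star S) = star (tensorOp T S) := by
  rw [ContinuousLinearMap.star_eq_adjoint (tensorOp T S), ContinuousLinearMap.eq_adjoint_iff]
  intro x y
  induction x using HilbertTensor.induction_on with
  | hp => exact isClosed_eq (by fun_prop) (by fun_prop)
  | ih x =>
  induction y using HilbertTensor.induction_on with
  | hp => exact isClosed_eq (by fun_prop) (by fun_prop)
  | ih y =>
    rw [tensorOp_of, tensorOp_of, LinearIsometry.inner_map_map, LinearIsometry.inner_map_map]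
    induction x with
    | zero => simp
    | add x x' hx hx' => simp only [map_add, inner_add_left, hx, hx']
    | tmul a b =>
      induction y with
      | zero => simp
      | add y y' hy hy' => simp only [map_add, inner_add_right, hy, hy']
      | tmul c d =>
        simp [ContinuousLinearMap.star_eq_adjoint, ContinuousLinearMap.adjoint_inner_left]

variable (H K) in
/-- The flip `x ⊗ y ↦ y ⊗ x` on Hilbert space tensor products. -/
def flipOp : HilbertTensor H K →L[ℂ] HilbertTensor K H :=
  (((TensorProduct.commIsometry ℂ H K).toContinuousLinearEquiv :
    H ⊗[ℂ] K →L[ℂ] K ⊗[ℂ] H).completion :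
    UniformSpace.Completion (H ⊗[ℂ] K) →L[ℂ] UniformSpace.Completion (K ⊗[ℂ] H))

theorem flipOp_of (x : H ⊗[ℂ] K) :
    flipOp H K (HilbertTensor.of H K x) = HilbertTensor.of K H (TensorProduct.comm ℂ H K x) :=
  ContinuousLinearMap.completion_apply_coe _ x

theorem norm_flipOp (x : HilbertTensor H K) : ‖flipOp H K x‖ = ‖x‖ := by
  induction x using HilbertTensor.induction_on with
  | hp => exact isClosed_eq (by fun_prop) (by fun_prop)
  | ih x =>
    rw [flipOp_of, LinearIsometry.norm_map, LinearIsometry.norm_map, TensorProduct.norm_comm]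

theorem flipOp_flipOp (x : HilbertTensor H K) : flipOp K H (flipOp H K x) = x := by
  induction x using HilbertTensor.induction_on with
  | hp => exact isClosed_eq (by fun_prop) (by fun_prop)
  | ih x => rw [flipOp_of, flipOp_of]; simp

theorem tensorOp_comp_flipOp (T : H →L[ℂ] H) (S : K →L[ℂ] K) :
    tensorOp S T ∘L flipOp H K = flipOp H K ∘L tensorOp T S :=
  tensorOp_ext fun a b => by
    simp only [ContinuousLinearMap.comp_apply, flipOp_of, TensorProduct.comm_tmul,
      tensorOp_of_tmul]

variable (H K) in
/-- `(T, S) ↦ T ⊗ S` as a bilinear map. -/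
def tensorOpBilin : (H →L[ℂ] H) →ₗ[ℂ] (K →L[ℂ] K) →ₗ[ℂ]
    (HilbertTensor H K →L[ℂ] HilbertTensor H K) :=
  LinearMap.mk₂ ℂ tensorOp
    (fun T T' S => tensorOp_ext fun a b => by
      simp only [add_apply, tensorOp_of_tmul, TensorProduct.add_tmul, map_add])
    (fun c T S => tensorOp_ext fun a b => by
      simp only [smul_apply, tensorOp_of_tmul, ← TensorProduct.smul_tmul',
        map_smul])
    (fun T S S' => tensorOp_ext fun a b => by
      simp only [add_apply, tensorOp_of_tmul, TensorProduct.tmul_add, map_add])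
    (fun c T S => tensorOp_ext fun a b => by
      simp only [smul_apply, tensorOp_of_tmul, TensorProduct.tmul_smul,
        map_smul])

end HilbertTensor

/-! ## The spatial norm on the algebraic tensor product -/

/-- A (unital) representation of a unital C⋆-algebra `A` on a Hilbert space. By the
Gelfand-Naimark theorem, Hilbert spaces in the universe of `A` suffice for a faithful one. -/
structure CStarRep (A : Type u) [CStarAlgebra A] where
  /-- the Hilbert space -/
  H : Type u
  [normed : NormedAddCommGroup H]
  [inner : InnerProductSpace ℂ H]
  [complete : CompleteSpace H]
  /-- the action -/
  π : A →⋆ₐ[ℂ] (H →L[ℂ] H)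

attribute [instance] CStarRep.normed CStarRep.inner CStarRep.complete

section SpatialNorm

variable {A B : Type u} [CStarAlgebra A] [CStarAlgebra B]

/-- The representation `π ⊗ σ` of the algebraic tensor product, as an algebra homomorphism. -/
def tensorRepAlg (π : CStarRep A) (σ : CStarRep B) :
    A ⊗[ℂ] B →ₐ[ℂ] (HilbertTensor π.H σ.H →L[ℂ] HilbertTensor π.H σ.H) :=
  Algebra.TensorProduct.algHomOfLinearMapTensorProduct
    (TensorProduct.lift ((tensorOpBilin π.H σ.H).compl₁₂
      π.π.toAlgHom.toLinearMap σ.π.toAlgHom.toLinearMap))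
    (fun a a' b b' => by simp [tensorOpBilin, tensorOp_mul])
    (by simp [tensorOpBilin, tensorOp_one])

theorem tensorRepAlg_tmul (π : CStarRep A) (σ : CStarRep B) (a : A) (b : B) :
    tensorRepAlg π σ (a ⊗ₜ[ℂ] b) = tensorOp (π.π a) (σ.π b) := by
  simp [tensorRepAlg, tensorOpBilin]

/-- The representation `π ⊗ σ` of the algebraic tensor product `A ⊗ B` on the Hilbert space tensor
product, `(π ⊗ σ) (a ⊗ b) = π a ⊗ σ b`. -/
def tensorRep (π : CStarRep A) (σ : CStarRep B) :
    A ⊗[ℂ] B →⋆ₐ[ℂ] (HilbertTensor π.H σ.H →L[ℂ] HilbertTensor π.H σ.H) where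
  __ := tensorRepAlg π σ
  map_star' x := by
    change tensorRepAlg π σ (star x) = star (tensorRepAlg π σ x)
    induction x with
    | zero => rw [star_zero, map_zero, star_zero]
    | add x y hx hy => rw [star_add, map_add, map_add, star_add, hx, hy]
    | tmul a b =>
      rw [TensorProduct.star_tmul, tensorRepAlg_tmul, tensorRepAlg_tmul, map_star, map_star,
        tensorOp_star]

theorem tensorRep_tmul (π : CStarRep A) (σ : CStarRep B) (a : A) (b : B) :
    tensorRep π σ (a ⊗ₜ[ℂ] b) = tensorOp (π.π a) (σ.π b) :=
  tensorRepAlg_tmul π σ a b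

/-- The spatial (minimal) norm on the algebraic tensor product: the supremum of
`‖(π ⊗ σ) x‖` over all representations `π` of `A` and `σ` of `B`. -/
def spatialNorm (x : A ⊗[ℂ] B) : ℝ :=
  ⨆ p : CStarRep A × CStarRep B, ‖tensorRep p.1 p.2 x‖

theorem bddAbove_spatialNorm (x : A ⊗[ℂ] B) :
    BddAbove (Set.range fun p : CStarRep A × CStarRep B => ‖tensorRep p.1 p.2 x‖) := by
  suffices h : ∃ C : ℝ, ∀ p : CStarRep A × CStarRep B, ‖tensorRep p.1 p.2 x‖ ≤ C by
    obtain ⟨C, hC⟩ := h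
    exact ⟨C, by rintro _ ⟨p, rfl⟩; exact hC p⟩
  induction x with
  | zero => exact ⟨0, fun p => by rw [map_zero, norm_zero]⟩
  | add x y hx hy =>
    obtain ⟨C, hC⟩ := hx
    obtain ⟨D, hD⟩ := hy
    exact ⟨C + D, fun p => by
      rw [map_add]; exact (norm_add_le _ _).trans (add_le_add (hC p) (hD p))⟩
  | tmul a b =>
    refine ⟨‖a‖ * ‖b‖, fun p => ?_⟩
    rw [tensorRep_tmul]
    refine (norm_tensorOp_le _ _).trans (mul_le_mul ?_ ?_ (norm_nonneg _) (norm_nonneg _))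
    · exact NonUnitalStarAlgHom.norm_apply_le p.1.π a
    · exact NonUnitalStarAlgHom.norm_apply_le p.2.π b

theorem norm_tensorRep_le (π : CStarRep A) (σ : CStarRep B) (x : A ⊗[ℂ] B) :
    ‖tensorRep π σ x‖ ≤ spatialNorm x :=
  le_ciSup (bddAbove_spatialNorm x) (π, σ)

instance : Nonempty (CStarRep A) :=
  ⟨{ H := PUnit
     π := { toFun := fun _ => 0
            map_one' := Subsingleton.elim _ _
            map_mul' := fun _ _ => Subsingleton.elim _ _
            map_zero' := rfl
            map_add' := fun _ _ => Subsingleton.elim _ _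
            commutes' := fun _ => Subsingleton.elim _ _
            map_star' := fun _ => Subsingleton.elim _ _ } }⟩

theorem spatialNorm_le {x : A ⊗[ℂ] B} {C : ℝ}
    (h : ∀ (π : CStarRep A) (σ : CStarRep B), ‖tensorRep π σ x‖ ≤ C) : spatialNorm x ≤ C :=
  ciSup_le fun p => h p.1 p.2

theorem spatialNorm_nonneg (x : A ⊗[ℂ] B) : 0 ≤ spatialNorm x :=
  Real.iSup_nonneg fun _ => norm_nonneg _

theorem spatialNorm_star_mul_self (x : A ⊗[ℂ] B) :
    spatialNorm (star x * x) = spatialNorm x * spatialNorm x := by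
  apply le_antisymm
  · refine spatialNorm_le fun π σ => ?_
    rw [map_mul, map_star, CStarRing.norm_star_mul_self]
    exact mul_self_le_mul_self (norm_nonneg _) (norm_tensorRep_le π σ x)
  · have h : spatialNorm x ≤ √(spatialNorm (star x * x)) := by
      refine spatialNorm_le fun π σ => Real.le_sqrt_of_sq_le ?_
      have := norm_tensorRep_le π σ (star x * x)
      rwa [map_mul, map_star, CStarRing.norm_star_mul_self, ← sq] at this
    rcases (spatialNorm_nonneg x).eq_or_lt with h0 | h0
    · rw [← h0, zero_mul]; exact spatialNorm_nonneg _
    · rw [← sq]; exact (Real.le_sqrt' h0).1 h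

theorem spatialNorm_zero : spatialNorm (0 : A ⊗[ℂ] B) = 0 :=
  le_antisymm (spatialNorm_le fun π σ => by rw [map_zero, norm_zero]) (spatialNorm_nonneg _)

theorem spatialNorm_add_le (x y : A ⊗[ℂ] B) :
    spatialNorm (x + y) ≤ spatialNorm x + spatialNorm y :=
  spatialNorm_le fun π σ => by
    rw [map_add]
    exact (norm_add_le _ _).trans (add_le_add (norm_tensorRep_le π σ x) (norm_tensorRep_le π σ y))

theorem spatialNorm_neg (x : A ⊗[ℂ] B) : spatialNorm (-x) = spatialNorm x := by
  unfold spatialNorm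
  simp only [map_neg, norm_neg]

theorem spatialNorm_mul_le (x y : A ⊗[ℂ] B) :
    spatialNorm (x * y) ≤ spatialNorm x * spatialNorm y :=
  spatialNorm_le fun π σ => by
    rw [map_mul]
    exact (norm_mul_le _ _).trans (mul_le_mul (norm_tensorRep_le π σ x) (norm_tensorRep_le π σ y)
      (norm_nonneg _) (spatialNorm_nonneg _))

theorem spatialNorm_smul_le (c : ℂ) (x : A ⊗[ℂ] B) :
    spatialNorm (c • x) ≤ ‖c‖ * spatialNorm x :=
  spatialNorm_le fun π σ => by
    rw [map_smul, norm_smul]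
    exact mul_le_mul_of_nonneg_left (norm_tensorRep_le π σ x) (norm_nonneg c)

theorem spatialNorm_star (x : A ⊗[ℂ] B) : spatialNorm (star x) = spatialNorm x := by
  unfold spatialNorm
  simp only [map_star, norm_star]

end SpatialNorm

/-! ## The spatial tensor product of two unital C⋆-algebras -/

section SpatialTensor

variable (A B : Type u) [CStarAlgebra A] [CStarAlgebra B]

/-- The algebraic tensor product `A ⊗ B`, carrying the spatial norm. -/
def AlgTensor : Type u := A ⊗[ℂ] B

namespace AlgTensor

instance : Ring (AlgTensor A B) := inferInstanceAs (Ring (A ⊗[ℂ] B))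

instance : StarRing (AlgTensor A B) := inferInstanceAs (StarRing (A ⊗[ℂ] B))

instance : Algebra ℂ (AlgTensor A B) := inferInstanceAs (Algebra ℂ (A ⊗[ℂ] B))

instance : StarModule ℂ (AlgTensor A B) := inferInstanceAs (StarModule ℂ (A ⊗[ℂ] B))

/-- The identity map from the algebraic tensor product to its copy with the spatial norm. -/
def of : A ⊗[ℂ] B ≃⋆ₐ[ℂ] AlgTensor A B :=
  StarAlgEquiv.refl (R := ℂ) (A := A ⊗[ℂ] B)

instance : SeminormedAddCommGroup (AlgTensor A B) :=
  AddGroupSeminorm.toSeminormedAddCommGroup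
    { toFun := fun x => spatialNorm ((of A B).symm x)
      map_zero' := spatialNorm_zero
      add_le' := spatialNorm_add_le (A := A) (B := B)
      neg' := spatialNorm_neg (A := A) (B := B) }

theorem norm_of (x : A ⊗[ℂ] B) : ‖of A B x‖ = spatialNorm x := rfl

instance : SeminormedRing (AlgTensor A B) where
  __ := (inferInstance : Ring (AlgTensor A B))
  __ := (inferInstance : SeminormedAddCommGroup (AlgTensor A B))
  norm_mul_le := spatialNorm_mul_le (A := A) (B := B)

instance : NormedAlgebra ℂ (AlgTensor A B) where
  norm_smul_le := spatialNorm_smul_le (A := A) (B := B)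

instance : NormedStarGroup (AlgTensor A B) where
  norm_star_le x := (spatialNorm_star (A := A) (B := B) x).le

theorem norm_star_mul_self (x : AlgTensor A B) : ‖star x * x‖ = ‖x‖ * ‖x‖ :=
  spatialNorm_star_mul_self (A := A) (B := B) x

end AlgTensor

/-- The spatial (minimal) tensor product of the unital C⋆-algebras `A` and `B`: the completion of
the algebraic tensor product for the spatial norm. -/
def SpatialTensor : Type u := UniformSpace.Completion (AlgTensor A B)

namespace SpatialTensor

open UniformSpace

instance : NormedRing (SpatialTensor A B) :=
  inferInstanceAs (NormedRing (Completion (AlgTensor A B)))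

instance : CompleteSpace (SpatialTensor A B) :=
  inferInstanceAs (CompleteSpace (Completion (AlgTensor A B)))

instance : Algebra ℂ (SpatialTensor A B) :=
  inferInstanceAs (Algebra ℂ (Completion (AlgTensor A B)))

instance : NormedAlgebra ℂ (SpatialTensor A B) where
  norm_smul_le := norm_smul_le (α := ℂ) (β := Completion (AlgTensor A B))

/-- The canonical map from the algebraic tensor product to the spatial tensor product, as an
algebra homomorphism. -/
def ofAlg : AlgTensor A B →ₐ[ℂ] SpatialTensor A B where
  toRingHom := (Completion.coeRingHom : AlgTensor A B →+* Completion (AlgTensor A B))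
  commutes' _ := rfl

theorem norm_ofAlg (x : AlgTensor A B) : ‖ofAlg A B x‖ = ‖x‖ := Completion.norm_coe x

theorem isometry_ofAlg : Isometry (ofAlg A B) :=
  AddMonoidHomClass.isometry_of_norm _ (norm_ofAlg A B)

theorem continuous_ofAlg : Continuous (ofAlg A B) := (isometry_ofAlg A B).continuous

theorem denseRange_ofAlg : DenseRange (ofAlg A B) := Completion.denseRange_coe

variable {A B} in
@[elab_as_elim]
theorem induction_on {p : SpatialTensor A B → Prop} (x : SpatialTensor A B)
    (hp : IsClosed {x | p x}) (ih : ∀ x, p (ofAlg A B x)) : p x :=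
  Completion.induction_on x hp ih

instance : Star (SpatialTensor A B) :=
  ⟨(Completion.map star : Completion (AlgTensor A B) → Completion (AlgTensor A B))⟩

theorem star_ofAlg (x : AlgTensor A B) : star (ofAlg A B x) = ofAlg A B (star x) :=
  Completion.map_coe (star_isometry (E := AlgTensor A B)).uniformContinuous x

theorem continuous_star' : Continuous (star : SpatialTensor A B → SpatialTensor A B) :=
  Completion.continuous_map (f := (star : AlgTensor A B → AlgTensor A B))

instance : StarRing (SpatialTensor A B) where
  star_involutive x := by
    induction x using induction_on with
    | hp =>
      exact isClosed_eq ((continuous_star' A B).comp (continuous_star' A B)) continuous_id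
    | ih x => rw [star_ofAlg, star_ofAlg, star_star]
  star_mul x y := by
    have hs := continuous_star' A B
    induction x using induction_on with
    | hp => exact isClosed_eq (by fun_prop) (by fun_prop)
    | ih x =>
      induction y using induction_on with
      | hp => exact isClosed_eq (by fun_prop) (by fun_prop)
      | ih y => simp only [← map_mul, star_ofAlg, star_mul]
  star_add x y := by
    have hs := continuous_star' A B
    induction x using induction_on with
    | hp => exact isClosed_eq (by fun_prop) (by fun_prop)
    | ih x =>
      induction y using induction_on with
      | hp => exact isClosed_eq (by fun_prop) (by fun_prop)
      | ih y => simp only [← map_add, star_ofAlg, star_add]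

instance : CStarRing (SpatialTensor A B) where
  norm_mul_self_le x := by
    have hs := continuous_star' A B
    induction x using induction_on with
    | hp => exact isClosed_le (by fun_prop) (by fun_prop)
    | ih x =>
      rw [star_ofAlg, ← map_mul, norm_ofAlg, norm_ofAlg, AlgTensor.norm_star_mul_self]

instance : StarModule ℂ (SpatialTensor A B) where
  star_smul c x := by
    have hs := continuous_star' A B
    induction x using induction_on with
    | hp =>
      exact isClosed_eq (hs.comp (continuous_const_smul c)) ((continuous_const_smul (star c)).comp hs)
    | ih x => rw [← map_smul, star_ofAlg, star_ofAlg, star_smul, map_smul]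

instance : CStarAlgebra (SpatialTensor A B) where

/-- The order of the C⋆-algebra: `x ≤ y` iff `y - x` is positive. -/
instance : PartialOrder (SpatialTensor A B) := CStarAlgebra.spectralOrder (SpatialTensor A B)

instance : StarOrderedRing (SpatialTensor A B) :=
  CStarAlgebra.spectralOrderedRing (SpatialTensor A B)

/-- The canonical ⋆-homomorphism from the algebraic to the spatial tensor product. -/
def incl : A ⊗[ℂ] B →⋆ₐ[ℂ] SpatialTensor A B where
  toAlgHom := (ofAlg A B).comp (AlgTensor.of A B : A ⊗[ℂ] B →ₐ[ℂ] AlgTensor A B)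
  map_star' x := (star_ofAlg A B (AlgTensor.of A B x)).symm

theorem norm_incl (x : A ⊗[ℂ] B) : ‖incl A B x‖ = spatialNorm x := norm_ofAlg A B _

theorem denseRange_incl : DenseRange (incl A B) := denseRange_ofAlg A B

variable {A B}

@[elab_as_elim]
theorem induction_incl {p : SpatialTensor A B → Prop} (x : SpatialTensor A B)
    (hp : IsClosed {x | p x}) (ih : ∀ x : A ⊗[ℂ] B, p (incl A B x)) : p x :=
  induction_on x hp ih

section lift

variable {C : Type*} [NormedAddCommGroup C] [NormedSpace ℂ C] [CompleteSpace C]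

/-- The extension to the spatial tensor product of a linear map on the algebraic tensor product
which is continuous for the spatial norm. -/
def extend (f : A ⊗[ℂ] B →ₗ[ℂ] C)
    (hf : Continuous fun x : AlgTensor A B => f ((AlgTensor.of A B).symm x)) :
    SpatialTensor A B →L[ℂ] C :=
  ContinuousLinearMap.extend
    (⟨f ∘ₗ ((AlgTensor.of A B).symm : AlgTensor A B →ₐ[ℂ] A ⊗[ℂ] B).toLinearMap, hf⟩ :
      AlgTensor A B →L[ℂ] C)
    (⟨(ofAlg A B).toLinearMap, continuous_ofAlg A B⟩ : AlgTensor A B →L[ℂ] SpatialTensor A B)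

theorem extend_incl (f : A ⊗[ℂ] B →ₗ[ℂ] C)
    (hf : Continuous fun x : AlgTensor A B => f ((AlgTensor.of A B).symm x)) (x : A ⊗[ℂ] B) :
    extend f hf (incl A B x) = f x :=
  ContinuousLinearMap.extend_eq _ (denseRange_ofAlg A B)
    (isometry_ofAlg A B).isUniformInducing (AlgTensor.of A B x)

end lift

section lift

variable {C : Type*} [CStarAlgebra C]

theorem continuous_of_norm_le (f : A ⊗[ℂ] B →⋆ₐ[ℂ] C) (hf : ∀ x, ‖f x‖ ≤ spatialNorm x) :
    Continuous fun x : AlgTensor A B =>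
      (f : A ⊗[ℂ] B →ₐ[ℂ] C).toLinearMap ((AlgTensor.of A B).symm x) :=
  AddMonoidHomClass.continuous_of_bound
    ((f : A ⊗[ℂ] B →ₐ[ℂ] C).toLinearMap ∘ₗ
      ((AlgTensor.of A B).symm : AlgTensor A B →ₐ[ℂ] A ⊗[ℂ] B).toLinearMap) 1
    (fun x => by rw [one_mul]; exact hf ((AlgTensor.of A B).symm x))

/-- The extension to the spatial tensor product of a ⋆-homomorphism on the algebraic tensor product
which is contractive for the spatial norm. -/
def lift (f : A ⊗[ℂ] B →⋆ₐ[ℂ] C) (hf : ∀ x, ‖f x‖ ≤ spatialNorm x) :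
    SpatialTensor A B →⋆ₐ[ℂ] C where
  toAlgHom := AlgHom.ofLinearMap
    (extend (f : A ⊗[ℂ] B →ₐ[ℂ] C).toLinearMap (continuous_of_norm_le f hf) :
      SpatialTensor A B →ₗ[ℂ] C)
    (by
      rw [← map_one (incl A B)]
      exact (extend_incl _ _ _).trans (map_one f))
    (by
      intro x y
      have hc := (extend (f : A ⊗[ℂ] B →ₐ[ℂ] C).toLinearMap (continuous_of_norm_le f hf)).continuous
      simp only [ContinuousLinearMap.coe_coe]
      induction x using induction_incl with
      | hp =>
        exact isClosed_eq (hc.comp (continuous_mul_const y)) (hc.mul continuous_const)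
      | ih x =>
        induction y using induction_incl with
        | hp =>
          exact isClosed_eq (hc.comp (continuous_const_mul _)) (continuous_const.mul hc)
        | ih y =>
          rw [← map_mul, extend_incl, extend_incl, extend_incl]
          exact map_mul f x y)
  map_star' x := by
    have hc := (extend (f : A ⊗[ℂ] B →ₐ[ℂ] C).toLinearMap (continuous_of_norm_le f hf)).continuous
    change extend (f : A ⊗[ℂ] B →ₐ[ℂ] C).toLinearMap (continuous_of_norm_le f hf) (star x) =
      star (extend (f : A ⊗[ℂ] B →ₐ[ℂ] C).toLinearMap (continuous_of_norm_le f hf) x)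
    induction x using induction_incl with
    | hp => exact isClosed_eq (hc.comp (continuous_star' A B)) (continuous_star.comp hc)
    | ih x =>
      rw [← map_star, extend_incl, extend_incl]
      exact map_star f x

theorem lift_incl (f : A ⊗[ℂ] B →⋆ₐ[ℂ] C) (hf : ∀ x, ‖f x‖ ≤ spatialNorm x) (x : A ⊗[ℂ] B) :
    lift f hf (incl A B x) = f x :=
  extend_incl _ _ x

end lift

section maps

variable {A' B' : Type u} [CStarAlgebra A'] [CStarAlgebra B']

/-- The algebraic tensor product of two ⋆-homomorphisms. -/
def algMap (φ : A →⋆ₐ[ℂ] A') (ψ : B →⋆ₐ[ℂ] B') : A ⊗[ℂ] B →⋆ₐ[ℂ] A' ⊗[ℂ] B' where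
  toAlgHom := Algebra.TensorProduct.map (φ : A →ₐ[ℂ] A') (ψ : B →ₐ[ℂ] B')
  map_star' x := by
    change Algebra.TensorProduct.map (φ : A →ₐ[ℂ] A') (ψ : B →ₐ[ℂ] B') (star x) =
      star (Algebra.TensorProduct.map (φ : A →ₐ[ℂ] A') (ψ : B →ₐ[ℂ] B') x)
    induction x with
    | zero => simp
    | add x y hx hy => simp only [star_add, map_add, hx, hy]
    | tmul a b => simp [map_star]

theorem algMap_tmul (φ : A →⋆ₐ[ℂ] A') (ψ : B →⋆ₐ[ℂ] B') (a : A) (b : B) :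
    algMap φ ψ (a ⊗ₜ b) = φ a ⊗ₜ ψ b := rfl

/-- The pullback of a representation along a ⋆-homomorphism. -/
def _root_.CStarRep.comp (π : CStarRep A') (φ : A →⋆ₐ[ℂ] A') : CStarRep A where
  H := π.H
  π := π.π.comp φ

theorem spatialNorm_algMap_le (φ : A →⋆ₐ[ℂ] A') (ψ : B →⋆ₐ[ℂ] B') (x : A ⊗[ℂ] B) :
    spatialNorm (algMap φ ψ x) ≤ spatialNorm x := by
  refine spatialNorm_le fun π σ => ?_
  have h : tensorRep π σ (algMap φ ψ x) = tensorRep (π.comp φ) (σ.comp ψ) x := by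
    induction x with
    | zero => rw [map_zero, map_zero, map_zero]; rfl
    | add x y hx hy => rw [map_add, map_add, map_add, hx, hy]; rfl
    | tmul a b => rw [algMap_tmul, tensorRep_tmul, tensorRep_tmul]; rfl
  rw [h]
  exact norm_tensorRep_le (π.comp φ) (σ.comp ψ) x

/-- The ⋆-homomorphism `φ ⊗ ψ` between spatial tensor products,
`(φ ⊗ ψ) (a ⊗ b) = φ a ⊗ ψ b`. -/
def map (φ : A →⋆ₐ[ℂ] A') (ψ : B →⋆ₐ[ℂ] B') : SpatialTensor A B →⋆ₐ[ℂ] SpatialTensor A' B' :=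
  lift ((incl A' B').comp (algMap φ ψ))
    (fun x => (norm_incl A' B' _).le.trans (spatialNorm_algMap_le φ ψ x))

theorem map_incl_tmul (φ : A →⋆ₐ[ℂ] A') (ψ : B →⋆ₐ[ℂ] B') (a : A) (b : B) :
    map φ ψ (incl A B (a ⊗ₜ b)) = incl A' B' (φ a ⊗ₜ ψ b) :=
  lift_incl _ _ _

end maps

variable (A B)

/-- The ⋆-homomorphism `a ↦ a ⊗ 1`. -/
def inl : A →⋆ₐ[ℂ] SpatialTensor A B :=
  (incl A B).comp
    { toAlgHom := Algebra.TensorProduct.includeLeft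
      map_star' := fun a => by simp }

/-- The ⋆-homomorphism `b ↦ 1 ⊗ b`. -/
def inr : B →⋆ₐ[ℂ] SpatialTensor A B :=
  (incl A B).comp
    { toAlgHom := Algebra.TensorProduct.includeRight
      map_star' := fun a => by simp }

theorem inl_apply (a : A) : inl A B a = incl A B (a ⊗ₜ 1) := rfl

theorem inr_apply (b : B) : inr A B b = incl A B (1 ⊗ₜ b) := rfl

/-- The flip on the algebraic tensor product. -/
def algFlip : A ⊗[ℂ] A →⋆ₐ[ℂ] A ⊗[ℂ] A where
  toAlgHom := (Algebra.TensorProduct.comm ℂ A A : A ⊗[ℂ] A →ₐ[ℂ] A ⊗[ℂ] A)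
  map_star' x := by
    change Algebra.TensorProduct.comm ℂ A A (star x) = star (Algebra.TensorProduct.comm ℂ A A x)
    induction x with
    | zero => simp
    | add x y hx hy => simp only [star_add, map_add, hx, hy]
    | tmul a b => simp

theorem algFlip_tmul (a b : A) : algFlip A (a ⊗ₜ b) = b ⊗ₜ a := rfl

theorem norm_tensorRep_algFlip_le (π σ : CStarRep A) (x : A ⊗[ℂ] A) :
    ‖tensorRep π σ (algFlip A x)‖ ≤ ‖tensorRep σ π x‖ := by
  have key : tensorRep π σ (algFlip A x) ∘L flipOp σ.H π.H =
      flipOp σ.H π.H ∘L tensorRep σ π x := by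
    induction x with
    | zero => rw [map_zero, map_zero, map_zero, ContinuousLinearMap.zero_comp,
        ContinuousLinearMap.comp_zero]
    | add x y hx hy => rw [map_add, map_add, map_add, ContinuousLinearMap.add_comp,
        ContinuousLinearMap.comp_add, hx, hy]
    | tmul a b => rw [algFlip_tmul, tensorRep_tmul, tensorRep_tmul, tensorOp_comp_flipOp]
  refine ContinuousLinearMap.opNorm_le_bound _ (norm_nonneg _) fun y => ?_
  have h := congrArg (fun f => f (flipOp π.H σ.H y)) key
  simp only [ContinuousLinearMap.comp_apply, flipOp_flipOp] at h
  rw [h, norm_flipOp, ← norm_flipOp y]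
  exact ContinuousLinearMap.le_opNorm _ _

/-- The flip of the spatial tensor product, `a ⊗ b ↦ b ⊗ a`. -/
def flip : SpatialTensor A A →⋆ₐ[ℂ] SpatialTensor A A :=
  lift ((incl A A).comp (algFlip A)) (fun x => (norm_incl A A _).le.trans
    (spatialNorm_le fun π σ =>
      (norm_tensorRep_algFlip_le A π σ x).trans (norm_tensorRep_le σ π x)))

theorem flip_incl_tmul (a b : A) : flip A (incl A A (a ⊗ₜ b)) = incl A A (b ⊗ₜ a) :=
  lift_incl _ _ _

end SpatialTensor

end SpatialTensor

/-! ## Algebraic quantum metrics -/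

section QuantumMetric

open SpatialTensor

variable (A : Type u) [CStarAlgebra A]

/-- The multiplication `a ⊗ b ↦ a * b` of `A`, on the algebraic tensor product, is continuous for
the spatial norm. -/
def HasSpatiallyContinuousMul : Prop :=
  Continuous fun x : AlgTensor A A => LinearMap.mul' ℂ A ((AlgTensor.of A A).symm x)

variable {A}

/-- The continuous extension `m : A ⊗ A → A` of the multiplication to the spatial tensor product. -/
def spatialMul (hA : HasSpatiallyContinuousMul A) : SpatialTensor A A →L[ℂ] A :=
  SpatialTensor.extend (LinearMap.mul' ℂ A) hA

theorem spatialMul_incl_tmul (hA : HasSpatiallyContinuousMul A) (a b : A) :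
    spatialMul hA (incl A A (a ⊗ₜ b)) = a * b :=
  (extend_incl _ _ _).trans (LinearMap.mul'_apply)

variable (A)

/-- The ⋆-homomorphism `a ⊗ b ↦ a ⊗ 1 ⊗ b`. -/
def legOneThree : SpatialTensor A A →⋆ₐ[ℂ] SpatialTensor (SpatialTensor A A) A :=
  SpatialTensor.map (inl A A) (StarAlgHom.id ℂ A)

/-- The ⋆-homomorphism `ρ ↦ ρ ⊗ 1`, that is, `a ⊗ b ↦ a ⊗ b ⊗ 1`. -/
def legOneTwo : SpatialTensor A A →⋆ₐ[ℂ] SpatialTensor (SpatialTensor A A) A :=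
  inl (SpatialTensor A A) A

/-- The ⋆-homomorphism `ρ ↦ 1 ⊗ ρ`, that is, `a ⊗ b ↦ 1 ⊗ a ⊗ b`. -/
def legTwoThree : SpatialTensor A A →⋆ₐ[ℂ] SpatialTensor (SpatialTensor A A) A :=
  SpatialTensor.map (inr A A) (StarAlgHom.id ℂ A)

variable {A}

/-- `(A, ρ)` is an algebraic compact quantum metric space: the multiplication `m` of `A` is
continuous for the spatial norm, and `ρ` is an algebraic quantum metric. -/
structure IsAlgebraicQuantumMetric (ρ : SpatialTensor A A) : Prop where
  hasSpatiallyContinuousMul : HasSpatiallyContinuousMul A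
  nonneg : 0 ≤ ρ
  mul_eq_zero : spatialMul hasSpatiallyContinuousMul ρ = 0
  isUnit_add : ∀ ν : SpatialTensor A A, 0 ≤ ν → spatialMul hasSpatiallyContinuousMul ν = 1 →
    SpatialTensor.flip A ν = ν → IsUnit (ρ + ν)
  flip_eq : SpatialTensor.flip A ρ = ρ
  triangle : legOneThree A ρ ≤ legOneTwo A ρ + legTwoThree A ρ

variable {A₁ A₂ : Type u} [CStarAlgebra A₁] [CStarAlgebra A₂]

/-- The element of `(A₁ ⊗ A₂) ⊗ (A₁ ⊗ A₂)` corresponding to `ρ₁ ⊗ 1 + 1 ⊗ ρ₂` under the canonical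
isomorphism `(A₁ ⊗ A₁) ⊗ (A₂ ⊗ A₂) ≅ (A₁ ⊗ A₂) ⊗ (A₁ ⊗ A₂)`,
`(a ⊗ a') ⊗ (b ⊗ b') ↦ (a ⊗ b) ⊗ (a' ⊗ b')`. On elementary tensors this isomorphism maps
`(a ⊗ a') ⊗ (1 ⊗ 1)` to `(a ⊗ 1) ⊗ (a' ⊗ 1)` and `(1 ⊗ 1) ⊗ (b ⊗ b')` to `(1 ⊗ b) ⊗ (1 ⊗ b')`. -/
def productMetric (ρ₁ : SpatialTensor A₁ A₁) (ρ₂ : SpatialTensor A₂ A₂) :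
    SpatialTensor (SpatialTensor A₁ A₂) (SpatialTensor A₁ A₂) :=
  SpatialTensor.map (inl A₁ A₂) (inl A₁ A₂) ρ₁ + SpatialTensor.map (inr A₁ A₂) (inr A₁ A₂) ρ₂

theorem productMetric_incl_tmul (a a' : A₁) (b b' : A₂) :
    productMetric (incl A₁ A₁ (a ⊗ₜ a')) (incl A₂ A₂ (b ⊗ₜ b')) =
      incl _ _ (incl A₁ A₂ (a ⊗ₜ 1) ⊗ₜ incl A₁ A₂ (a' ⊗ₜ 1)) +
        incl _ _ (incl A₁ A₂ (1 ⊗ₜ b) ⊗ₜ incl A₁ A₂ (1 ⊗ₜ b')) := by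
  rw [productMetric, map_incl_tmul, map_incl_tmul]; rfl

end QuantumMetric

end

/-! Since `A₁` is commutative, `(A₁ ⊗ A₂) ⊗ (A₁ ⊗ A₂)` is a bundle of C⋆-algebras over the
character space of `A₁ ⊗ A₁`, that is, over the pairs `(x, y)` of characters of `A₁`, with fibres
`A₂ ⊗ A₂`. An element of such a bundle is invertible if it is so in every fibre: a maximal left
ideal containing it would, by Schur's lemma and the Gelfand–Mazur theorem, sit over a single
point of the base. In the fibre over `(x, y)` the element `ρ + ν` becomes
`ρ₁(x, y) + ρ₂ + ν(x, y)`. If `ρ₁(x, y) > 0`, this is strictly positive. If `ρ₁(x, y) = 0`, then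
`x = y`, since otherwise `ρ₁ + ν₁` would vanish at `(x, y)` for some admissible `ν₁`; and on the
diagonal `ν(x, x)` is admissible for `ρ₂`. -/

open scoped CStarAlgebra

-- By Schur's lemma `c - f` is bijective or zero, and it is not bijective for `c` in the spectrum.
theorem exists_eq_smul_of_isSimpleModule {R V : Type*} [Ring R] [Algebra ℂ R]
    [NormedAddCommGroup V] [NormedSpace ℂ V] [CompleteSpace V] [Module R V] [IsScalarTower ℂ R V]
    [IsSimpleModule R V] {f : V →ₗ[R] V} (hf : Continuous f) : ∃ c : ℂ, ∀ v, f v = c • v := by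
  have : Nontrivial V := IsSimpleModule.nontrivial R V
  let T : V →L[ℂ] V := ⟨f.restrictScalars ℂ, hf⟩
  obtain ⟨c, hc⟩ := spectrum.nonempty T
  let g : V →ₗ[R] V := Module.toModuleEnd R (S := ℂ) V c - f
  have hg : ¬ Function.Bijective g := fun h => hc (ContinuousLinearMap.isUnit_iff_bijective.2 h)
  exact ⟨c, fun v =>
    (sub_eq_zero.1 (DFunLike.congr_fun (g.bijective_or_eq_zero.resolve_left hg) v)).symm⟩

section Fibres

variable {C M : Type*} [Ring C] [Algebra ℂ C] [NormedRing M] [NormedAlgebra ℂ M]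

theorem exists_sub_algebraMap_mem_of_isMaximal [CompleteSpace M] {z : M} (hz : ∀ m, Commute z m)
    (L : Ideal M) [hL : L.IsMaximal] : ∃ c : ℂ, z - algebraMap ℂ M c ∈ L := by
  have : IsSimpleModule M (M ⧸ L) := isSimpleModule_iff_isCoatom.2 (Ideal.isMaximal_def.1 hL)
  have hzL : L ≤ Submodule.comap (LinearMap.toSpanSingleton M M z) L := fun m hm => by
    rw [Submodule.mem_comap, LinearMap.toSpanSingleton_apply, smul_eq_mul, ← (hz m).eq]
    exact L.mul_mem_left z hm
  let f : (M ⧸ L) →ₗ[M] M ⧸ L := L.mapQ L (LinearMap.toSpanSingleton M M z) hzL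
  have hf : Continuous f := (continuous_quot_mk.comp (continuous_mul_const z)).quotient_lift _
  obtain ⟨c, hc⟩ := exists_eq_smul_of_isSimpleModule hf
  refine ⟨c, (Submodule.Quotient.eq L).1 ?_⟩
  simpa [f, Algebra.algebraMap_eq_smul_one] using hc (Submodule.Quotient.mk 1)

theorem exists_algHom_forall_sub_mem_of_isMaximal [CompleteSpace M] {ι : C →ₐ[ℂ] M}
    (hι : ∀ c m, Commute (ι c) m) (L : Ideal M) [hL : L.IsMaximal] :
    ∃ ω : C →ₐ[ℂ] ℂ, ∀ c, ι c - algebraMap ℂ M (ω c) ∈ L := by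
  choose ω hω using fun c => exists_sub_algebraMap_mem_of_isMaximal (hι c) L
  have ω_eq {c : C} {s : ℂ} (hs : ι c - algebraMap ℂ M s ∈ L) : ω c = s := by
    by_contra hne
    have hmem : algebraMap ℂ M (ω c - s) ∈ L := by
      simpa only [map_sub, sub_sub_sub_cancel_left] using L.sub_mem hs (hω c)
    exact hL.ne_top (L.eq_top_of_isUnit_mem hmem ((sub_ne_zero.2 hne).isUnit.map _))
  have ω_algebraMap (s : ℂ) : ω (algebraMap ℂ C s) = s := ω_eq (by simp)
  have hadd (c d : C) : ι (c + d) - algebraMap ℂ M (ω c + ω d) ∈ L := by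
    simpa only [map_add, add_sub_add_comm] using L.add_mem (hω c) (hω d)
  have hmul (c d : C) : ι (c * d) - algebraMap ℂ M (ω c * ω d) ∈ L := by
    have e : ι (c * d) - algebraMap ℂ M (ω c * ω d) =
        ι c * (ι d - algebraMap ℂ M (ω d)) +
          algebraMap ℂ M (ω d) * (ι c - algebraMap ℂ M (ω c)) := by
      rw [map_mul, map_mul, mul_sub, mul_sub, Algebra.commutes (ω d) (ι c), Algebra.commutes (ω c),
        sub_add_sub_cancel]
    exact e ▸ L.add_mem (L.mul_mem_left _ (hω d)) (L.mul_mem_left _ (hω c))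
  exact ⟨{ toFun := ω
           map_one' := by simpa only [map_one] using ω_algebraMap 1
           map_mul' := fun c d => ω_eq (hmul c d)
           map_zero' := by simpa only [map_zero] using ω_algebraMap 0
           map_add' := fun c d => ω_eq (hadd c d)
           commutes' := ω_algebraMap }, hω⟩

section FibreMap

variable {B : Type*} [Ring B] [Algebra ℂ B]

/-- The surjection `φ : M → B` identifies `B` with the fibre at the character `ω` of `M`, seen as
an algebra over `C` through `ι`: the quotient of `M` by the closed ideal generated by the kernel
of `ω`. -/
structure IsFibreMap (ι : C →ₐ[ℂ] M) (ω : C →ₐ[ℂ] ℂ) (φ : M →ₐ[ℂ] B) : Prop where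
  surjective : Function.Surjective φ
  ker_eq : RingHom.ker φ = ((RingHom.ker ω).map ι).closure

theorem IsFibreMap.ker_le_of_isMaximal [CompleteSpace M] {ι : C →ₐ[ℂ] M} {ω : C →ₐ[ℂ] ℂ}
    {φ : M →ₐ[ℂ] B} (hφ : IsFibreMap ι ω φ) {L : Ideal M} [hL : L.IsMaximal]
    (hω : ∀ c, ι c - algebraMap ℂ M (ω c) ∈ L) : RingHom.ker φ ≤ L := by
  have hker : (RingHom.ker ω).map ι ≤ L := Ideal.map_le_iff_le_comap.2 fun c hc => by
    simpa [(RingHom.mem_ker ..).1 hc] using hω c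
  rw [hφ.ker_eq, ← hL.closure_eq]
  exact closure_mono hker

theorem IsFibreMap.of_section [TopologicalSpace B] [T1Space B] {ι : C →ₐ[ℂ] M} {ω : C →ₐ[ℂ] ℂ}
    {φ : M →ₐ[ℂ] B} (hφ : Continuous φ) {j : B →ₐ[ℂ] M} (hj : Continuous j)
    (hι : ∀ c m, Commute (ι c) m) (h : ∀ c b, φ (ι c * j b) = ω c • b)
    (hdense : Dense (Submodule.span ℂ (Set.range fun p : C × B => ι p.1 * j p.2) : Set M)) :
    IsFibreMap ι ω φ := by
  let I : Ideal M := ((RingHom.ker ω).map ι).closure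
  have hI {c : C} (hc : ω c = 0) : ι c ∈ I := subset_closure (Ideal.mem_map_of_mem ι hc)
  have hφι (c : C) : φ (ι c) = ω c • 1 := by simpa using h c 1
  have hφj (b : B) : φ (j b) = b := by simpa using h 1 b
  let K : Submodule ℂ M := (I.restrictScalars ℂ).comap
    (LinearMap.id - j.toLinearMap ∘ₗ φ.toLinearMap)
  have hK : IsClosed (K : Set M) := isClosed_closure.preimage (continuous_id.sub (hj.comp hφ))
  have hmem (m : M) : m - j (φ m) ∈ I := by
    refine (hK.closure_subset_iff.2 (Submodule.span_le.2 ?_)) (hdense m)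
    rintro _ ⟨⟨c, b⟩, rfl⟩
    have e : ι c * j b - j (φ (ι c * j b)) = j b * ι (c - algebraMap ℂ C (ω c)) := by
      rw [h, map_smul, map_sub, AlgHom.commutes, mul_sub, (hι c _).eq, Algebra.smul_def,
        Algebra.commutes]
    change ι c * j b - j (φ (ι c * j b)) ∈ I
    rw [e]
    exact I.mul_mem_left _ (hI (by simp))
  refine ⟨fun b => ⟨j b, hφj b⟩, le_antisymm (fun m hm => ?_) ?_⟩
  · simpa [(RingHom.mem_ker ..).1 hm] using hmem m
  · refine closure_minimal ?_ (isClosed_singleton.preimage hφ)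
    exact Ideal.map_le_iff_le_comap.2 fun c hc => by
      simp [RingHom.mem_ker, hφι, (RingHom.mem_ker ..).1 hc]

end FibreMap

section Invertibility

variable [CompleteSpace M] {X : Type*} {B : X → Type*} [∀ x, Ring (B x)] [∀ x, Algebra ℂ (B x)]
  {ι : C →ₐ[ℂ] M} {ω : X → C →ₐ[ℂ] ℂ} {φ : ∀ x, M →ₐ[ℂ] B x}

theorem exists_mul_eq_one_of_forall_fibre (hι : ∀ c m, Commute (ι c) m)
    (hω : Function.Surjective ω) (hφ : ∀ x, IsFibreMap ι (ω x) (φ x)) {w : M}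
    (hw : ∀ x, IsUnit (φ x w)) : ∃ u, u * w = 1 := by
  rw [← Ideal.mem_span_singleton', ← Ideal.eq_top_iff_one]
  by_contra hne
  obtain ⟨L, hL, hwL⟩ := Ideal.exists_le_maximal _ hne
  obtain ⟨χ, hχ⟩ := exists_algHom_forall_sub_mem_of_isMaximal hι L
  obtain ⟨x, rfl⟩ := hω χ
  obtain ⟨b, hb⟩ := (hw x).exists_left_inv
  obtain ⟨v, rfl⟩ := (hφ x).surjective b
  have hvw : v * w - 1 ∈ L := (hφ x).ker_le_of_isMaximal hχ
    (by rw [RingHom.mem_ker, map_sub, map_mul, map_one, hb, sub_self])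
  have hvw' : v * w ∈ L := L.mul_mem_left v (hwL (Ideal.mem_span_singleton_self w))
  exact hL.ne_top (L.eq_top_iff_one.2 (by simpa using L.sub_mem hvw' hvw))

theorem isUnit_of_forall_fibre (hι : ∀ c m, Commute (ι c) m)
    (hω : Function.Surjective ω) (hφ : ∀ x, IsFibreMap ι (ω x) (φ x)) {w : M}
    (hw : ∀ x, IsUnit (φ x w)) : IsUnit w := by
  obtain ⟨u, huw⟩ := exists_mul_eq_one_of_forall_fibre hι hω hφ hw
  have hu (x : X) : IsUnit (φ x u) := by
    obtain ⟨b, hb⟩ := hw x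
    refine (Units.isUnit_mul_units (φ x u) b).1 ?_
    rw [hb, ← map_mul, huw, map_one]
    exact isUnit_one
  obtain ⟨v, hvu⟩ := exists_mul_eq_one_of_forall_fibre hι hω hφ hu
  have hvw : v = w := left_inv_eq_right_inv hvu huw
  exact ⟨⟨w, u, hvw ▸ hvu, huw⟩, rfl⟩

end Invertibility

end Fibres

section CStarFibres

variable {C M X : Type*} {B : X → Type*} [Ring C] [Algebra ℂ C] [CStarAlgebra M]
  [∀ x, CStarAlgebra (B x)] {ι : C →ₐ[ℂ] M} {ω : X → C →ₐ[ℂ] ℂ} {φ : ∀ x, M →⋆ₐ[ℂ] B x}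

theorem norm_le_of_forall_fibre (hι : ∀ c m, Commute (ι c) m) (hω : Function.Surjective ω)
    (hφ : ∀ x, IsFibreMap ι (ω x) (φ x).toAlgHom) {m : M} {r : ℝ} (hr : 0 ≤ r)
    (hm : ∀ x, ‖φ x m‖ ≤ r) : ‖m‖ ≤ r := by
  cases subsingleton_or_nontrivial M
  · rwa [Subsingleton.elim m 0, norm_zero]
  obtain ⟨k, hk, hkm⟩ := spectrum.exists_nnnorm_eq_spectralRadius (star m * m)
  rw [(IsSelfAdjoint.star_mul_self m).spectralRadius_eq_nnnorm] at hkm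
  obtain ⟨x, hx⟩ : ∃ x, k ∈ spectrum ℂ (φ x (star m * m)) := by
    by_contra! h
    refine hk (isUnit_of_forall_fibre hι hω hφ fun x => ?_)
    rw [map_sub, AlgHom.commutes]
    exact spectrum.notMem_iff.1 (h x)
  have : Nontrivial (B x) := by
    by_contra! h
    simp [spectrum.of_subsingleton] at hx
  refine abs_le_of_sq_le_sq' ?_ hr |>.2
  calc ‖m‖ ^ 2 = ‖k‖ := by
        rw [sq, ← CStarRing.norm_star_mul_self]
        exact congrArg NNReal.toReal (ENNReal.coe_injective hkm).symm
    _ ≤ ‖φ x (star m * m)‖ := spectrum.norm_le_norm_of_mem hx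
    _ = ‖φ x m‖ ^ 2 := by rw [map_mul, map_star, CStarRing.norm_star_mul_self, sq]
    _ ≤ r ^ 2 := pow_le_pow_left₀ (norm_nonneg _) (hm x) 2

end CStarFibres

theorem starAlgHom_toAlgHom_surjective {A : Type*} [CStarAlgebra A] :
    Function.Surjective (StarAlgHom.toAlgHom : (A →⋆ₐ[ℂ] ℂ) → A →ₐ[ℂ] ℂ) := fun χ =>
  ⟨{ toAlgHom := χ, map_star' := map_star χ }, rfl⟩

namespace SpatialTensor

section Elementary

variable {A B A' B' : Type u} [CStarAlgebra A] [CStarAlgebra B] [CStarAlgebra A'] [CStarAlgebra B']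

@[elab_as_elim]
theorem induction_tmul {p : SpatialTensor A B → Prop} (x : SpatialTensor A B)
    (isClosed : IsClosed {x | p x}) (add : ∀ x y, p x → p y → p (x + y))
    (tmul : ∀ a b, p (incl A B (a ⊗ₜ b))) : p x := by
  induction x using induction_incl with
  | hp => exact isClosed
  | ih x =>
    induction x with
    | zero => simpa only [TensorProduct.zero_tmul] using tmul 0 0
    | add x y hx hy => simpa only [map_add] using add _ _ hx hy
    | tmul a b => exact tmul a b

theorem incl_tmul_mul_incl_tmul (a a' : A) (b b' : B) :
    incl A B (a ⊗ₜ b) * incl A B (a' ⊗ₜ b') = incl A B ((a * a') ⊗ₜ (b * b')) := by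
  rw [← map_mul, Algebra.TensorProduct.tmul_mul_tmul]

theorem inl_mul_inr (a : A) (b : B) : inl A B a * inr A B b = incl A B (a ⊗ₜ b) := by
  rw [inl_apply, inr_apply, incl_tmul_mul_incl_tmul, mul_one, one_mul]

theorem commute_map {φ : A →⋆ₐ[ℂ] A'} {ψ : B →⋆ₐ[ℂ] B'} (hφ : ∀ a x, Commute (φ a) x)
    (hψ : ∀ b y, Commute (ψ b) y) (c : SpatialTensor A B) (x : SpatialTensor A' B') :
    Commute (map φ ψ c) x := by
  induction c using induction_tmul with
  | isClosed => exact isClosed_eq (by fun_prop) (by fun_prop)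
  | add c d hc hd => simpa only [map_add] using hc.add_left hd
  | tmul a b =>
    induction x using induction_tmul with
    | isClosed => exact isClosed_eq (by fun_prop) (by fun_prop)
    | add x y hx hy => exact hx.add_right hy
    | tmul a' b' =>
      rw [map_incl_tmul, Commute, SemiconjBy, incl_tmul_mul_incl_tmul, incl_tmul_mul_incl_tmul,
        (hφ a a').eq, (hψ b b').eq]

theorem dense_span_inl_mul_inr :
    Dense (Submodule.span ℂ (Set.range fun p : A × B => inl A B p.1 * inr A B p.2) :
      Set (SpatialTensor A B)) := fun x => by
  induction x using induction_tmul with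
  | isClosed => exact isClosed_closure
  | add x y hx hy => exact add_mem (s := (Submodule.span ℂ _).topologicalClosure) hx hy
  | tmul a b => exact subset_closure (Submodule.subset_span ⟨(a, b), inl_mul_inr a b⟩)

theorem dense_span_map_inl_mul_map_inr :
    Dense (Submodule.span ℂ (Set.range fun p : SpatialTensor A A' × SpatialTensor B B' =>
        map (inl A B) (inl A' B') p.1 * map (inr A B) (inr A' B') p.2) :
      Set (SpatialTensor (SpatialTensor A B) (SpatialTensor A' B'))) := fun z => by
  induction z using induction_tmul with
  | isClosed => exact isClosed_closure
  | add z w hz hw => exact add_mem (s := (Submodule.span ℂ _).topologicalClosure) hz hw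
  | tmul x y =>
    rw [← inl_mul_inr]
    induction x using induction_tmul with
    | isClosed => exact isClosed_closure.preimage (by fun_prop)
    | add x x' hx hx' =>
      rw [map_add, add_mul]
      exact add_mem (s := (Submodule.span ℂ _).topologicalClosure) hx hx'
    | tmul a b =>
      induction y using induction_tmul with
      | isClosed => exact isClosed_closure.preimage (by fun_prop)
      | add y y' hy hy' =>
        rw [map_add, mul_add]
        exact add_mem (s := (Submodule.span ℂ _).topologicalClosure) hy hy'
      | tmul a' b' =>
        refine subset_closure (Submodule.subset_span
          ⟨(incl A A' (a ⊗ₜ a'), incl B B' (b ⊗ₜ b')), ?_⟩)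
        simp only [map_incl_tmul, incl_tmul_mul_incl_tmul, inl_mul_inr]

end Elementary

theorem commute_inl {A B : Type u} [CommCStarAlgebra A] [CStarAlgebra B] (a : A)
    (x : SpatialTensor A B) : Commute (inl A B a) x := by
  induction x using induction_tmul with
  | isClosed => exact isClosed_eq (by fun_prop) (by fun_prop)
  | add x y hx hy => exact hx.add_right hy
  | tmul a' b =>
    rw [inl_apply, Commute, SemiconjBy, incl_tmul_mul_incl_tmul, incl_tmul_mul_incl_tmul,
      mul_comm a, one_mul, mul_one]

section Slice

variable {A B : Type u} [CStarAlgebra A] [CStarAlgebra B]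

/-- The slice map `a ⊗ b ↦ χ a • b` along a character `χ`, on the algebraic tensor product. -/
noncomputable def algSlice (χ : A →⋆ₐ[ℂ] ℂ) : A ⊗[ℂ] B →⋆ₐ[ℂ] B where
  toAlgHom := (Algebra.TensorProduct.lid ℂ B : ℂ ⊗[ℂ] B →ₐ[ℂ] B).comp
    (Algebra.TensorProduct.map χ.toAlgHom (AlgHom.id ℂ B))
  map_star' x := by
    induction x with
    | zero => simp
    | add x y hx hy => simp_all
    | tmul a b => simp [map_star]

theorem algSlice_tmul (χ : A →⋆ₐ[ℂ] ℂ) (a : A) (b : B) : algSlice χ (a ⊗ₜ b) = χ a • b := rfl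

-- The multiplication is a left inverse of `inr`, so no faithful representation of `B` is needed.
theorem norm_inr_of_hasSpatiallyContinuousMul (hB : HasSpatiallyContinuousMul B) (b : B) :
    ‖inr B B b‖ = ‖b‖ := by
  refine NonUnitalStarAlgHom.norm_map (inr B B) (Function.LeftInverse.injective
    (g := spatialMul hB) fun b => ?_) b
  rw [inr_apply, spatialMul_incl_tmul, one_mul]

theorem inr_algSlice (χ : A →⋆ₐ[ℂ] ℂ) (x : A ⊗[ℂ] B) :
    inr B B (algSlice χ x) =
      map ((StarAlgHom.ofId ℂ B).comp χ) (StarAlgHom.id ℂ B) (incl A B x) := by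
  induction x with
  | zero => simp only [map_zero]
  | add x y hx hy => simp only [map_add, hx, hy]
  | tmul a b =>
    rw [map_incl_tmul, algSlice_tmul, inr_apply, ← TensorProduct.smul_tmul,
      ← Algebra.algebraMap_eq_smul_one, StarAlgHom.comp_apply, StarAlgHom.ofId_apply,
      StarAlgHom.coe_id, id_eq]

theorem norm_algSlice_le (hB : HasSpatiallyContinuousMul B) (χ : A →⋆ₐ[ℂ] ℂ) (x : A ⊗[ℂ] B) :
    ‖algSlice χ x‖ ≤ spatialNorm x := by
  rw [← norm_inr_of_hasSpatiallyContinuousMul hB, inr_algSlice, ← norm_incl]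
  exact NonUnitalStarAlgHom.norm_apply_le _ _

/-- The slice map `a ⊗ b ↦ χ a • b` along a character `χ`, on the spatial tensor product. -/
noncomputable def slice (hB : HasSpatiallyContinuousMul B) (χ : A →⋆ₐ[ℂ] ℂ) :
    SpatialTensor A B →⋆ₐ[ℂ] B :=
  lift (algSlice χ) (norm_algSlice_le hB χ)

theorem slice_incl_tmul (hB : HasSpatiallyContinuousMul B) (χ : A →⋆ₐ[ℂ] ℂ) (a : A) (b : B) :
    slice hB χ (incl A B (a ⊗ₜ b)) = χ a • b :=
  (lift_incl _ _ _).trans (algSlice_tmul χ a b)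

theorem slice_inl (hB : HasSpatiallyContinuousMul B) (χ : A →⋆ₐ[ℂ] ℂ) (a : A) :
    slice hB χ (inl A B a) = χ a • (1 : B) :=
  slice_incl_tmul hB χ a 1

theorem slice_inr (hB : HasSpatiallyContinuousMul B) (χ : A →⋆ₐ[ℂ] ℂ) (b : B) :
    slice hB χ (inr A B b) = b := by
  rw [inr_apply, slice_incl_tmul, map_one, one_smul]

variable {A' B' : Type u} [CStarAlgebra A'] [CStarAlgebra B']

/-- The slice map `(a ⊗ b) ⊗ (a' ⊗ b') ↦ ω (a ⊗ a') • b ⊗ b'` along a character `ω` of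
`A ⊗ A'`. -/
noncomputable def pairSlice (hB : HasSpatiallyContinuousMul B) (hB' : HasSpatiallyContinuousMul B')
    (ω : SpatialTensor A A' →⋆ₐ[ℂ] ℂ) :
    SpatialTensor (SpatialTensor A B) (SpatialTensor A' B') →⋆ₐ[ℂ] SpatialTensor B B' :=
  map (slice hB (ω.comp (inl A A'))) (slice hB' (ω.comp (inr A A')))

theorem pairSlice_map_inl (hB : HasSpatiallyContinuousMul B) (hB' : HasSpatiallyContinuousMul B')
    (ω : SpatialTensor A A' →⋆ₐ[ℂ] ℂ) (c : SpatialTensor A A') :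
    pairSlice hB hB' ω (map (inl A B) (inl A' B') c) = ω c • 1 := by
  induction c using induction_tmul with
  | isClosed => exact isClosed_eq (by fun_prop) (by fun_prop)
  | add c d hc hd => rw [map_add, map_add, hc, hd, map_add, add_smul]
  | tmul a a' =>
    rw [pairSlice, map_incl_tmul, map_incl_tmul, slice_inl, slice_inl, ← inl_mul_inr a a', map_mul,
      TensorProduct.smul_tmul_smul, map_smul, ← Algebra.TensorProduct.one_def, map_one,
      StarAlgHom.comp_apply, StarAlgHom.comp_apply]

theorem pairSlice_map_inr (hB : HasSpatiallyContinuousMul B) (hB' : HasSpatiallyContinuousMul B')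
    (ω : SpatialTensor A A' →⋆ₐ[ℂ] ℂ) (d : SpatialTensor B B') :
    pairSlice hB hB' ω (map (inr A B) (inr A' B') d) = d := by
  induction d using induction_tmul with
  | isClosed => exact isClosed_eq (by fun_prop) (by fun_prop)
  | add d e hd he => rw [map_add, map_add, hd, he]
  | tmul b b' => rw [pairSlice, map_incl_tmul, map_incl_tmul, slice_inr, slice_inr]

end Slice

theorem isFibreMap_slice {A B : Type u} [CommCStarAlgebra A] [CStarAlgebra B]
    (hB : HasSpatiallyContinuousMul B) (χ : A →⋆ₐ[ℂ] ℂ) :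
    IsFibreMap (inl A B).toAlgHom χ.toAlgHom (slice hB χ).toAlgHom :=
  .of_section (j := (inr A B).toAlgHom) (map_continuous (slice hB χ)) (map_continuous (inr A B))
    commute_inl
    (fun a b => (congrArg (slice hB χ) (inl_mul_inr a b)).trans (slice_incl_tmul hB χ a b))
    dense_span_inl_mul_inr

theorem norm_le_of_forall_slice {A B : Type u} [CommCStarAlgebra A] [CStarAlgebra B]
    (hB : HasSpatiallyContinuousMul B) {x : SpatialTensor A B} {r : ℝ} (hr : 0 ≤ r)
    (hx : ∀ χ : A →⋆ₐ[ℂ] ℂ, ‖slice hB χ x‖ ≤ r) : ‖x‖ ≤ r :=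
  norm_le_of_forall_fibre (φ := slice hB) commute_inl starAlgHom_toAlgHom_surjective
    (isFibreMap_slice hB) hr hx

section PairSlice

variable {A B A' B' : Type u} [CommCStarAlgebra A] [CStarAlgebra B] [CommCStarAlgebra A']
  [CStarAlgebra B']

theorem isFibreMap_pairSlice (hB : HasSpatiallyContinuousMul B)
    (hB' : HasSpatiallyContinuousMul B') (ω : SpatialTensor A A' →⋆ₐ[ℂ] ℂ) :
    IsFibreMap (map (inl A B) (inl A' B')).toAlgHom ω.toAlgHom (pairSlice hB hB' ω).toAlgHom :=
  .of_section (j := (map (inr A B) (inr A' B')).toAlgHom) (map_continuous (pairSlice hB hB' ω))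
    (map_continuous (map (inr A B) (inr A' B'))) (commute_map commute_inl commute_inl)
    (fun c d =>
      show pairSlice hB hB' ω (map (inl A B) (inl A' B') c * map (inr A B) (inr A' B') d) =
          ω c • d by
        rw [map_mul, pairSlice_map_inl, pairSlice_map_inr, smul_one_mul])
    dense_span_map_inl_mul_map_inr

theorem isUnit_of_forall_pairSlice (hB : HasSpatiallyContinuousMul B)
    (hB' : HasSpatiallyContinuousMul B')
    {w : SpatialTensor (SpatialTensor A B) (SpatialTensor A' B')}
    (hw : ∀ ω : SpatialTensor A A' →⋆ₐ[ℂ] ℂ, IsUnit (pairSlice hB hB' ω w)) : IsUnit w :=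
  isUnit_of_forall_fibre (φ := fun ω => (pairSlice hB hB' ω).toAlgHom)
    (commute_map commute_inl commute_inl) starAlgHom_toAlgHom_surjective
    (isFibreMap_pairSlice hB hB') hw

end PairSlice

end SpatialTensor

open SpatialTensor

theorem HasSpatiallyContinuousMul.spatialTensor {A B : Type u} [CommCStarAlgebra A]
    [CStarAlgebra B] (hB : HasSpatiallyContinuousMul B) :
    HasSpatiallyContinuousMul (SpatialTensor A B) := by
  let T := SpatialTensor A B
  have slice_mul (χ : A →⋆ₐ[ℂ] ℂ) (z : T ⊗[ℂ] T) : slice hB χ (LinearMap.mul' ℂ T z) =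
      spatialMul hB (map (slice hB χ) (slice hB χ) (incl T T z)) := by
    induction z with
    | zero => simp only [map_zero]
    | add z w hz hw => simp only [map_add, hz, hw]
    | tmul x y => rw [map_incl_tmul, spatialMul_incl_tmul, LinearMap.mul'_apply, map_mul]
  have norm_mul_le (z : T ⊗[ℂ] T) :
      ‖LinearMap.mul' ℂ T z‖ ≤ ‖spatialMul hB‖ * spatialNorm z := by
    refine norm_le_of_forall_slice hB (by positivity [spatialNorm_nonneg z]) fun χ => ?_
    calc ‖slice hB χ (LinearMap.mul' ℂ T z)‖
        ≤ ‖spatialMul hB‖ * ‖map (slice hB χ) (slice hB χ) (incl T T z)‖ :=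
          slice_mul χ z ▸ (spatialMul hB).le_opNorm _
      _ ≤ ‖spatialMul hB‖ * spatialNorm z := by
          rw [← norm_incl]
          gcongr
          exact NonUnitalStarAlgHom.norm_apply_le _ _
  exact AddMonoidHomClass.continuous_of_bound
    (LinearMap.mul' ℂ T ∘ₗ ((AlgTensor.of T T).symm : AlgTensor T T →ₐ[ℂ] T ⊗[ℂ] T).toLinearMap)
    _ fun x => norm_mul_le _

section Naturality

variable {A B : Type u} [CStarAlgebra A] [CStarAlgebra B] (φ : A →⋆ₐ[ℂ] B)

theorem spatialMul_map (hA : HasSpatiallyContinuousMul A) (hB : HasSpatiallyContinuousMul B)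
    (x : SpatialTensor A A) : spatialMul hB (map φ φ x) = φ (spatialMul hA x) := by
  induction x using induction_tmul with
  | isClosed => exact isClosed_eq (by fun_prop) (by fun_prop)
  | add x y hx hy => simp only [map_add, hx, hy]
  | tmul a b => rw [map_incl_tmul, spatialMul_incl_tmul, spatialMul_incl_tmul, map_mul]

theorem flip_map (x : SpatialTensor A A) :
    SpatialTensor.flip B (map φ φ x) = map φ φ (SpatialTensor.flip A x) := by
  induction x using induction_tmul with
  | isClosed => exact isClosed_eq (by fun_prop) (by fun_prop)
  | add x y hx hy => simp only [map_add, hx, hy]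
  | tmul a b => simp only [map_incl_tmul, flip_incl_tmul]

theorem legOneThree_map (x : SpatialTensor A A) :
    legOneThree B (map φ φ x) = map (map φ φ) φ (legOneThree A x) := by
  induction x using induction_tmul with
  | isClosed => exact isClosed_eq (by fun_prop) (by fun_prop)
  | add x y hx hy => simp only [map_add, hx, hy]
  | tmul a b =>
    simp only [legOneThree, map_incl_tmul, inl_apply, map_one, StarAlgHom.coe_id, id_eq]

theorem legOneTwo_map (x : SpatialTensor A A) :
    legOneTwo B (map φ φ x) = map (map φ φ) φ (legOneTwo A x) := by
  simp only [legOneTwo, inl_apply, map_incl_tmul, map_one]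

theorem legTwoThree_map (x : SpatialTensor A A) :
    legTwoThree B (map φ φ x) = map (map φ φ) φ (legTwoThree A x) := by
  induction x using induction_tmul with
  | isClosed => exact isClosed_eq (by fun_prop) (by fun_prop)
  | add x y hx hy => simp only [map_add, hx, hy]
  | tmul a b =>
    simp only [legTwoThree, map_incl_tmul, inr_apply, map_one, StarAlgHom.coe_id, id_eq]

end Naturality

theorem spatialMul_one {A : Type u} [CStarAlgebra A] (hA : HasSpatiallyContinuousMul A) :
    spatialMul hA 1 = 1 :=
  (spatialMul_incl_tmul hA 1 1).trans (one_mul 1)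

section Commutative

variable {A : Type u} [CommCStarAlgebra A]

theorem spatialMul_mul (hA : HasSpatiallyContinuousMul A) (x y : SpatialTensor A A) :
    spatialMul hA (x * y) = spatialMul hA x * spatialMul hA y := by
  induction x using induction_tmul with
  | isClosed => exact isClosed_eq (by fun_prop) (by fun_prop)
  | add x x' hx hx' => simp only [add_mul, map_add, hx, hx']
  | tmul a b =>
    induction y using induction_tmul with
    | isClosed => exact isClosed_eq (by fun_prop) (by fun_prop)
    | add y y' hy hy' => simp only [mul_add, map_add, hy, hy']
    | tmul a' b' => simp only [incl_tmul_mul_incl_tmul, spatialMul_incl_tmul, mul_mul_mul_comm]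

theorem spatialMul_star (hA : HasSpatiallyContinuousMul A) (x : SpatialTensor A A) :
    spatialMul hA (star x) = star (spatialMul hA x) := by
  induction x using induction_tmul with
  | isClosed => exact isClosed_eq (by fun_prop) (by fun_prop)
  | add x y hx hy => simp only [star_add, map_add, hx, hy]
  | tmul a b =>
    rw [← map_star, TensorProduct.star_tmul, spatialMul_incl_tmul, spatialMul_incl_tmul, star_mul']

theorem exists_nonneg_spatialMul_eq_one_flip_eq_map_eq_zero (hA : HasSpatiallyContinuousMul A)
    {ω : SpatialTensor A A →⋆ₐ[ℂ] ℂ} (hω : ω.comp (inl A A) ≠ ω.comp (inr A A)) :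
    ∃ ν, 0 ≤ ν ∧ spatialMul hA ν = 1 ∧ SpatialTensor.flip A ν = ν ∧ ω ν = 0 := by
  obtain ⟨a, ha⟩ := DFunLike.ne_iff.1 hω
  let d : SpatialTensor A A := inl A A a - inr A A a
  have spatialMul_d : spatialMul hA d = 0 := by
    rw [map_sub, inl_apply, inr_apply, spatialMul_incl_tmul, spatialMul_incl_tmul, mul_one,
      one_mul, sub_self]
  have flip_d : SpatialTensor.flip A d = -d := by
    rw [map_sub, neg_sub, inl_apply, inr_apply, flip_incl_tmul, flip_incl_tmul]
  have map_d : ω d ≠ 0 := by rwa [map_sub, sub_ne_zero]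
  -- `d ^ 2 / ω d ^ 2` is symmetric, vanishes on the diagonal and equals `1` at `ω`.
  let q : SpatialTensor A A := 1 - (ω d ^ 2)⁻¹ • d ^ 2
  have spatialMul_q : spatialMul hA q = 1 := by
    rw [map_sub, map_smul, sq d, spatialMul_mul, spatialMul_d, mul_zero, smul_zero, sub_zero,
      spatialMul_one]
  have flip_q : SpatialTensor.flip A q = q := by
    rw [map_sub, map_one, map_smul, map_pow, flip_d, neg_sq]
  have map_q : ω q = 0 := by
    rw [map_sub, map_one, map_smul, map_pow, smul_eq_mul, inv_mul_cancel₀ (pow_ne_zero 2 map_d),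
      sub_self]
  exact ⟨star q * q, star_mul_self_nonneg q,
    by rw [spatialMul_mul, spatialMul_star, spatialMul_q, star_one, one_mul],
    by rw [map_mul, map_star, flip_q], by rw [map_mul, map_q, mul_zero]⟩

theorem IsAlgebraicQuantumMetric.comp_inl_eq_comp_inr {ρ : SpatialTensor A A}
    (h : IsAlgebraicQuantumMetric ρ) {ω : SpatialTensor A A →⋆ₐ[ℂ] ℂ} (hω : ω ρ = 0) :
    ω.comp (inl A A) = ω.comp (inr A A) := by
  by_contra hne
  obtain ⟨ν, hν, hmν, hfν, hων⟩ :=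
    exists_nonneg_spatialMul_eq_one_flip_eq_map_eq_zero h.hasSpatiallyContinuousMul hne
  refine ((h.isUnit_add ν hν hmν hfν).map ω).ne_zero ?_
  rw [map_add, hω, hων, add_zero]

end Commutative

open scoped ComplexOrder in
theorem IsAlgebraicQuantumMetric.isUnit_productMetric_add {A₁ A₂ : Type u} [CommCStarAlgebra A₁]
    [CStarAlgebra A₂] {ρ₁ : SpatialTensor A₁ A₁} {ρ₂ : SpatialTensor A₂ A₂}
    (h₁ : IsAlgebraicQuantumMetric ρ₁) (h₂ : IsAlgebraicQuantumMetric ρ₂)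
    (hm : HasSpatiallyContinuousMul (SpatialTensor A₁ A₂))
    {ν : SpatialTensor (SpatialTensor A₁ A₂) (SpatialTensor A₁ A₂)} (hν : 0 ≤ ν)
    (hmν : spatialMul hm ν = 1) (hfν : SpatialTensor.flip _ ν = ν) :
    IsUnit (productMetric ρ₁ ρ₂ + ν) := by
  have hA₂ := h₂.hasSpatiallyContinuousMul
  refine isUnit_of_forall_pairSlice hA₂ hA₂ fun ω => ?_
  rw [productMetric, map_add, map_add, pairSlice_map_inl, pairSlice_map_inr]
  have hων : 0 ≤ pairSlice hA₂ hA₂ ω ν := map_nonneg _ hν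
  rcases (map_nonneg ω h₁.nonneg).eq_or_lt with hω | hω
  · rw [← hω, zero_smul, zero_add]
    rw [pairSlice, ← h₁.comp_inl_eq_comp_inr hω.symm] at hων ⊢
    refine h₂.isUnit_add _ hων ?_ ?_
    · rw [spatialMul_map _ hm, hmν, map_one]
    · rw [flip_map, hfν]
  · rw [add_assoc, ← Algebra.algebraMap_eq_smul_one]
    exact ((isStrictlyPositive_algebraMap hω).add_nonneg (add_nonneg h₂.nonneg hων)).isUnit

theorem theorem7 {A₁ A₂ : Type u} [CommCStarAlgebra A₁] [CStarAlgebra A₂]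
    (ρ₁ : SpatialTensor A₁ A₁) (ρ₂ : SpatialTensor A₂ A₂)
    (h₁ : IsAlgebraicQuantumMetric ρ₁) (h₂ : IsAlgebraicQuantumMetric ρ₂) :
    IsAlgebraicQuantumMetric (productMetric ρ₁ ρ₂) where
  hasSpatiallyContinuousMul := h₂.hasSpatiallyContinuousMul.spatialTensor
  nonneg := add_nonneg (map_nonneg _ h₁.nonneg) (map_nonneg _ h₂.nonneg)
  mul_eq_zero := by
    rw [productMetric, map_add, spatialMul_map _ h₁.hasSpatiallyContinuousMul,
      spatialMul_map _ h₂.hasSpatiallyContinuousMul, h₁.mul_eq_zero, h₂.mul_eq_zero, map_zero,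
      map_zero, add_zero]
  isUnit_add _ := h₁.isUnit_productMetric_add h₂ _
  flip_eq := by rw [productMetric, map_add, flip_map, flip_map, h₁.flip_eq, h₂.flip_eq]
  triangle := by
    simp only [productMetric, map_add, legOneThree_map, legOneTwo_map, legTwoThree_map]
    rw [add_add_add_comm, ← map_add, ← map_add]
    exact add_le_add (OrderHomClass.mono _ h₁.triangle) (OrderHomClass.mono _ h₂.triangle)
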